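/- For $s\in\mathbb R$ let $D^s$ be the completion of the complex vector space $D$ spanned by the functions $\sin(kx)$, $k=1,2,\ldots$, on $(0,\pi)$, for the norm $\big\|\sum_k c_k\sin(kx)\big\|_s^2=\sum_k k^{2s}|c_k|^2$; for $s\le r$ we regard $D^r$ as a subspace of $D^s$. For $y_0\in D^s$ and $y_1\in D^{s-1}$, a solution of the classical string problem $$y''-y_{xx}=0 \text{ in } \mathbb R\times(0,\pi),\qquad y=0 \text{ on } \mathbb R\times\{0,\pi\},\qquad y(0)=y_0,\quad y'(0)=y_1$$ is a function $y\in C(\mathbb R,D^s)\cap C^1(\mathbb R,D^{s-1})\cap C^2(\mathbb R,D^{s-2})$ with these initial values that satisfies the equation in $D^{s-2}$ at all times, where $f\mapsto f_{xx}$ maps $\sum_k c_k\sin(kx)\in D^s$ to $\sum_k(-k^2c_k)\sin(kx)\in D^{s-2}$ (the boundary condition is contained in $y(t)\in D^s$). Let $r,s\in\mathbb R$ and $m=\max(r,s)$ (so $m=r$ in the case of interest $s\le r$). A pair $(t_0,t_1)\in\mathbb R^2$ is called strategic if there is a constant $c>0$ such that $$\|y_0\|_s+\|y_1\|_{s-1}\le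 c\,\big(\|y(t_0)\|_r+\|y(t_1)\|_r\big)$$ for all initial data $(y_0,y_1)\in D^m\times D^{m-1}$ and the corresponding solution $y$. Theorem. (a) If $r-s<1$, there is no strategic pair. (b) If $r-s=1$, the set of strategic pairs has zero Lebesgue measure and Hausdorff dimension $2$ in $\mathbb R^2$. (c) If $r-s>1$, the set of strategic pairs has full Lebesgue measure in $\mathbb R^2$, i.e. almost every pair $(t_0,t_1)\in\mathbb R^2$ is strategic. -/

import Mathlib

noncomputable section

namespace ClassicalString

/-- The coefficient sequences `(c_k)` of the formal sine series `∑_{k ≥ 1} c_k sin (k x)` for which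
`∑_{k ≥ 1} k ^ (2 s) |c_k| ^ 2` converges. -/
def sineSubmodule (s : ℝ) : Submodule ℂ (ℕ+ → ℂ) where
  carrier := {c | Summable fun k : ℕ+ => (k : ℝ) ^ (2 * s) * ‖c k‖ ^ 2}
  zero_mem' := by simp
  add_mem' := by
    intro a b ha hb
    refine Summable.of_nonneg_of_le (fun k => by positivity) (fun k => ?_)
      ((ha.add hb).mul_left 2)
    have h0 : (0 : ℝ) ≤ (k : ℝ) ^ (2 * s) := by positivity
    have h1 : ‖(a + b) k‖ ≤ ‖a k‖ + ‖b k‖ := norm_add_le _ _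
    have h2 : ‖(a + b) k‖ ^ 2 ≤ 2 * (‖a k‖ ^ 2 + ‖b k‖ ^ 2) := by
      nlinarith [norm_nonneg ((a + b) k), norm_nonneg (a k), norm_nonneg (b k),
        sq_nonneg (‖a k‖ - ‖b k‖)]
    nlinarith [mul_le_mul_of_nonneg_left h2 h0]
  smul_mem' := by
    intro z a ha
    refine (Summable.mul_left (‖z‖ ^ 2) ha).congr (fun k => ?_)
    simp only [Pi.smul_apply, smul_eq_mul, norm_mul]
    ring

/-- The space `D^s` (`s` any real number): the completion of the space of finite sums
`∑ c_k sin (k x)` with complex coefficients for the norm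
`‖∑ c_k sin (k x)‖_s ^ 2 = ∑ k ^ (2 s) |c_k| ^ 2`. It is realised as the space of the formal sine
series of finite norm; `instCompleteSpace` and `dense_finite` below state that this is indeed
the completion. It is a type of its own, so as to carry the topology of its norm and not the
topology of coefficientwise convergence. -/
def D (s : ℝ) : Type := ↥(sineSubmodule s)

namespace D

variable {s : ℝ}

instance : AddCommGroup (D s) := inferInstanceAs (AddCommGroup ↥(sineSubmodule s))

instance : Module ℂ (D s) := inferInstanceAs (Module ℂ ↥(sineSubmodule s))

/-- The sine coefficients of an element of `D^s`. -/
def coeff : D s →ₗ[ℂ] (ℕ+ → ℂ) := (sineSubmodule s).subtype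

/-- The element of `D^s` with given coefficients. -/
def mk (c : ℕ+ → ℂ) (hc : Summable fun k : ℕ+ => (k : ℝ) ^ (2 * s) * ‖c k‖ ^ 2) : D s := ⟨c, hc⟩

theorem summable_coeff (f : D s) :
    Summable fun k : ℕ+ => (k : ℝ) ^ (2 * s) * ‖coeff f k‖ ^ 2 := f.2

@[simp] theorem coeff_mk (c : ℕ+ → ℂ)
    (hc : Summable fun k : ℕ+ => (k : ℝ) ^ (2 * s) * ‖c k‖ ^ 2) :
    coeff (mk c hc : D s) = c := rfl

theorem ext_coeff {f g : D s} (h : ∀ k, coeff f k = coeff g k) : f = g :=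
  Subtype.ext (funext h)

instance : Norm (D s) := ⟨fun f => √(∑' k : ℕ+, (k : ℝ) ^ (2 * s) * ‖coeff f k‖ ^ 2)⟩

theorem norm_def (f : D s) : ‖f‖ = √(∑' k : ℕ+, (k : ℝ) ^ (2 * s) * ‖coeff f k‖ ^ 2) := rfl

theorem norm_weight_sq (k : ℕ+) (z : ℂ) :
    ‖(((k : ℝ) ^ s : ℝ) : ℂ) * z‖ ^ 2 = (k : ℝ) ^ (2 * s) * ‖z‖ ^ 2 := by
  have h0 : (0 : ℝ) ≤ (k : ℝ) := by positivity
  have h1 : (0 : ℝ) ≤ (k : ℝ) ^ s := by positivity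
  rw [norm_mul, Complex.norm_real, Real.norm_of_nonneg h1, mul_pow, ← Real.rpow_natCast,
    ← Real.rpow_mul h0, mul_comm s]
  norm_num

theorem memℓp_iff (c : ℕ+ → ℂ) :
    Memℓp (fun k : ℕ+ => (((k : ℝ) ^ s : ℝ) : ℂ) * c k) 2 ↔
      Summable fun k : ℕ+ => (k : ℝ) ^ (2 * s) * ‖c k‖ ^ 2 := by
  rw [memℓp_gen_iff (by norm_num)]
  refine summable_congr fun k => ?_
  rw [← norm_weight_sq]
  norm_num

/-- The linear bijection of `D^s` with `ℓ²` that multiplies the `k`-th coefficient by `k ^ s`. -/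
def toL2 (s : ℝ) : D s ≃ₗ[ℂ] lp (fun _ : ℕ+ => ℂ) 2 where
  toFun f := ⟨fun k => (((k : ℝ) ^ s : ℝ) : ℂ) * coeff f k, (memℓp_iff _).2 (summable_coeff f)⟩
  map_add' f g := by
    ext k
    exact mul_add _ _ _
  map_smul' z f := by
    ext k
    simp [mul_left_comm]
  invFun u := mk (fun k => (((k : ℝ) ^ s : ℝ) : ℂ)⁻¹ * u k) <| by
    rw [← memℓp_iff]
    convert lp.memℓp u using 1
    funext k
    have : (((k : ℝ) ^ s : ℝ) : ℂ) ≠ 0 := by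
      have : (0 : ℝ) < (k : ℝ) ^ s := by positivity
      exact_mod_cast this.ne'
    field_simp
  left_inv f := by
    refine ext_coeff fun k => ?_
    have : (((k : ℝ) ^ s : ℝ) : ℂ) ≠ 0 := by
      have : (0 : ℝ) < (k : ℝ) ^ s := by positivity
      exact_mod_cast this.ne'
    simp only [coeff_mk]
    field_simp
  right_inv u := by
    ext k
    have : (((k : ℝ) ^ s : ℝ) : ℂ) ≠ 0 := by
      have : (0 : ℝ) < (k : ℝ) ^ s := by positivity
      exact_mod_cast this.ne'
    simp only [coeff_mk]
    field_simp

theorem norm_toL2 (f : D s) : ‖toL2 s f‖ = ‖f‖ := by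
  rw [lp.norm_eq_tsum_rpow (by norm_num), norm_def, Real.sqrt_eq_rpow]
  norm_num
  congr 1
  exact tsum_congr fun k => norm_weight_sq k _

instance : NormedAddCommGroup (D s) :=
  NormedAddCommGroup.ofCore (𝕜 := ℂ)
    { norm_nonneg := fun f => Real.sqrt_nonneg _
      norm_smul := fun z f => by rw [← norm_toL2, map_smul, norm_smul, norm_toL2]
      norm_triangle := fun f g => by
        rw [← norm_toL2, ← norm_toL2 f, ← norm_toL2 g, map_add]
        exact norm_add_le _ _
      norm_eq_zero_iff := fun f => by
        rw [← norm_toL2, norm_eq_zero, LinearEquiv.map_eq_zero_iff] }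

instance : NormedSpace ℂ (D s) where
  norm_smul_le z f := by rw [← norm_toL2, map_smul, norm_smul, norm_toL2]

/-- `toL2` as an isometry. -/
def toL2Isometry (s : ℝ) : D s ≃ₗᵢ[ℂ] lp (fun _ : ℕ+ => ℂ) 2 := ⟨toL2 s, norm_toL2⟩

instance instCompleteSpace : CompleteSpace (D s) :=
  ((toL2Isometry s).toIsometryEquiv.completeSpace_iff).2 inferInstance

/-- The finite sine sums are dense in `D^s`. -/
theorem dense_finite : Dense {f : D s | (Function.support (coeff f)).Finite} := by
  intro f
  have h1 := (lp.hasSum_single (p := 2) (by norm_num) (toL2Isometry s f)).mapL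
    ((toL2Isometry s).symm.toContinuousLinearEquiv : lp (fun _ : ℕ+ => ℂ) 2 →L[ℂ] D s)
  have h2 : ((toL2Isometry s).symm.toContinuousLinearEquiv :
      lp (fun _ : ℕ+ => ℂ) 2 →L[ℂ] D s) (toL2Isometry s f) = f :=
    (toL2Isometry s).symm_apply_apply f
  rw [h2] at h1
  refine mem_closure_of_tendsto h1 (Filter.Eventually.of_forall fun A => ?_)
  refine A.finite_toSet.subset fun k hk => ?_
  by_contra hkA
  refine hk ?_
  rw [map_sum, Finset.sum_apply]
  refine Finset.sum_eq_zero fun j hj => ?_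
  have hjk : k ≠ j := fun h => hkA (h ▸ hj)
  change (((k : ℝ) ^ s : ℝ) : ℂ)⁻¹ * ((lp.single 2 j (toL2Isometry s f j) :
    lp (fun _ : ℕ+ => ℂ) 2) k) = 0
  rw [lp.single_apply_ne _ _ _ hjk, mul_zero]

/-- The natural inclusion of `D^r` in `D^s` for `s ≤ r`. -/
def incl {r s : ℝ} (h : s ≤ r) (f : D r) : D s :=
  mk (coeff f) <| by
    refine Summable.of_nonneg_of_le (fun k => by positivity) (fun k => ?_) (summable_coeff f)
    have hk : (1 : ℝ) ≤ (k : ℝ) := by exact_mod_cast k.pos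
    gcongr

/-- The operator `f ↦ f_xx` from `D^s` to `D^{s-2}`: since `(sin (k x))_xx = - k ^ 2 sin (k x)`, it
multiplies the `k`-th coefficient by `- k ^ 2`. -/
def dxx {s : ℝ} (f : D s) : D (s - 2) :=
  mk (fun k => -(k : ℂ) ^ 2 * coeff f k) <| by
    refine (summable_coeff f).congr fun k => ?_
    have hk : (0 : ℝ) < (k : ℝ) := by positivity
    have h1 : ‖(-(k : ℂ) ^ 2 * coeff f k)‖ = (k : ℝ) ^ 2 * ‖coeff f k‖ := by simp
    have h2 : (k : ℝ) ^ (2 * (s - 2)) = (k : ℝ) ^ (2 * s) / (k : ℝ) ^ 4 := by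
      rw [show 2 * (s - 2) = 2 * s - (4 : ℕ) by push_cast; ring, Real.rpow_sub hk,
        Real.rpow_natCast]
    rw [h1, h2]
    field_simp

end D

/-- `y ∈ C(ℝ, D^s) ∩ C¹(ℝ, D^{s-1}) ∩ C²(ℝ, D^{s-2})` is the solution of the problem
`y'' - y_xx = 0` in `ℝ × (0, π)`, `y = 0` on `ℝ × {0, π}`, `y(0) = y₀`, `y'(0) = y₁` with initial
data `(y₀, y₁) ∈ D^s × D^{s-1}`. The equation is an identity in `D^{s-2}`, and the boundary
condition is contained in `y(t) ∈ D^s`. -/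
structure IsSolution {s : ℝ} (y₀ : D s) (y₁ : D (s - 1)) (y : ℝ → D s) : Prop where
  continuous : Continuous y
  contDiff_one : ContDiff ℝ 1 fun t => D.incl (sub_le_self s one_pos.le) (y t)
  contDiff_two : ContDiff ℝ 2 fun t => D.incl (sub_le_self s two_pos.le) (y t)
  wave_eq : ∀ t, iteratedDeriv 2 (fun t => D.incl (sub_le_self s two_pos.le) (y t)) t
    = D.dxx (y t)
  init : y 0 = y₀
  init_deriv : deriv (fun t => D.incl (sub_le_self s one_pos.le) (y t)) 0 = y₁

/-- The pairs `(t₀, t₁)` of times such that, for some constant `c > 0`,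
`‖y₀‖_s + ‖y₁‖_{s-1} ≤ c (‖y(t₀)‖_r + ‖y(t₁)‖_r)` holds for every solution of the string problem with
initial data in `D^m × D^{m-1}`, where `m = max r s`. In the case of interest `s ≤ r` the data
range over `D^r × D^{r-1}`; in the case `r < s` they range over `D^s × D^{s-1}`, so that all the
norms in the inequality are finite. -/
def strategicPairs (r s : ℝ) : Set (ℝ × ℝ) :=
  {p | ∃ c : ℝ, 0 < c ∧
    ∀ (y₀ : D (max r s)) (y₁ : D (max r s - 1)) (y : ℝ → D (max r s)), IsSolution y₀ y₁ y →
      ‖D.incl (le_max_right r s) y₀‖ + ‖D.incl (sub_le_sub_right (le_max_right r s) 1) y₁‖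
        ≤ c * (‖D.incl (le_max_left r s) (y p.1)‖ + ‖D.incl (le_max_left r s) (y p.2)‖)}

end ClassicalString

end

/-! ### Coefficients, norms and single modes in `D s` -/

noncomputable section

namespace ClassicalString

namespace D

/-! The `k`-th coefficient of a solution is `a cos (k t) + b sin (k t)`. Its values at `t₀` and `t₁`
form a 2 × 2 linear system for `(a, b)` with determinant `sin (k (t₁ - t₀))`. Hence a pair is
strategic iff `k ^ (r - s) |sin (k (t₁ - t₀))|` is bounded below by a positive constant
(`mem_strategicPairs_iff`).

Since `|sin (k T)|` is comparable to the distance from `k x` to the integers, `x = T / π`, this is a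
Diophantine condition on `x`. Exponents below `1` contradict Dirichlet's theorem. For exponents
above `1` almost every `x` qualifies, as almost no number is Liouville with an exponent above `2`.
Exponent `1` means that `x` is badly approximable: a null condition by Cassels's lemma on limsup
sets (`ae_not_badlyApproximable`), yet one of full dimension.

For the dimension, Cantor sets of badly approximable numbers are mapped onto `[0, 1]` by functions
that are Hölder with exponent `ρ` close to `1` (`exists_holder_surjOn`). Shearing gives Hölder maps
from sets of strategic pairs onto the unit square, so the dimension is at least `2 ρ`. -/

theorem weight_mul_norm_coeff_le {s : ℝ} (f : D s) (k : ℕ+) :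
    (k : ℝ) ^ s * ‖coeff f k‖ ≤ ‖f‖ := by
  rw [norm_def]
  apply Real.le_sqrt_of_sq_le
  have h := (summable_coeff f).le_tsum k (fun j _ => by positivity)
  rw [← norm_weight_sq, norm_mul, Complex.norm_real, Real.norm_of_nonneg (by positivity)] at h
  exact h

/-- The `k`-th sine coefficient as a continuous linear functional on `D^s`. -/
def coeffCLM (s : ℝ) (k : ℕ+) : D s →L[ℂ] ℂ :=
  LinearMap.mkContinuous ((LinearMap.proj k).comp coeff) ((k : ℝ) ^ s)⁻¹ fun f => by
    have hk : (0 : ℝ) < (k : ℝ) ^ s := by positivity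
    rw [inv_mul_eq_div, le_div_iff₀ hk, mul_comm]
    exact weight_mul_norm_coeff_le f k

theorem coeff_dxx {s : ℝ} (f : D s) (k : ℕ+) : coeff (dxx f) k = -(k : ℂ) ^ 2 * coeff f k := rfl

theorem norm_sq_eq {s : ℝ} (f : D s) :
    ‖f‖ ^ 2 = ∑' k : ℕ+, (k : ℝ) ^ (2 * s) * ‖coeff f k‖ ^ 2 := by
  rw [norm_def, Real.sq_sqrt (tsum_nonneg fun k => by positivity)]

/-- A coefficientwise bound between elements of three of the spaces gives a bound of norms. -/
theorem norm_le_of_coeff_le {σ ρ C : ℝ} (hC : 0 ≤ C) (f : D σ) (g h : D ρ)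
    (H : ∀ k : ℕ+, (k : ℝ) ^ σ * ‖coeff f k‖
      ≤ C * ((k : ℝ) ^ ρ * ‖coeff g k‖ + (k : ℝ) ^ ρ * ‖coeff h k‖)) :
    ‖f‖ ≤ 2 * C * (‖g‖ + ‖h‖) := by
  -- By `(u + v) ^ 2 ≤ 2 (u ^ 2 + v ^ 2)`; the final constant `2 * C` rounds up `√2 * C`.
  have key : ‖f‖ ^ 2 ≤ 2 * C ^ 2 * (‖g‖ ^ 2 + ‖h‖ ^ 2) := by
    rw [norm_sq_eq, norm_sq_eq, norm_sq_eq,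
      ← (summable_coeff g).tsum_add (summable_coeff h), ← tsum_mul_left]
    refine (summable_coeff f).tsum_le_tsum (fun k => ?_)
      (((summable_coeff g).add (summable_coeff h)).mul_left _)
    have h1 := pow_le_pow_left₀ (by positivity) (H k) 2
    rw [← norm_weight_sq, ← norm_weight_sq, ← norm_weight_sq]
    simp only [norm_mul, Complex.norm_real]
    rw [Real.norm_of_nonneg (by positivity : (0 : ℝ) ≤ (k : ℝ) ^ σ),
      Real.norm_of_nonneg (by positivity : (0 : ℝ) ≤ (k : ℝ) ^ ρ)]
    refine h1.trans ?_
    nlinarith [mul_nonneg (sq_nonneg C)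
      (sq_nonneg ((k : ℝ) ^ ρ * ‖coeff g k‖ - (k : ℝ) ^ ρ * ‖coeff h k‖))]
  refine le_of_sq_le_sq (key.trans ?_) (by positivity)
  have := mul_nonneg (norm_nonneg g) (norm_nonneg h)
  nlinarith [mul_nonneg (sq_nonneg C) this, mul_nonneg (sq_nonneg C) (sq_nonneg ‖g‖),
    mul_nonneg (sq_nonneg C) (sq_nonneg ‖h‖)]

/-- The element `sin (k x)` of `D^s`. -/
def sine (s : ℝ) (k : ℕ+) : D s :=
  mk (Pi.single k 1) <| summable_of_ne_finset_zero (s := {k}) fun j hj => by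
    rw [Finset.mem_singleton] at hj
    simp [Pi.single_eq_of_ne hj]

theorem coeff_sine (s : ℝ) (k : ℕ+) : coeff (sine s k) = Pi.single k 1 := rfl

theorem norm_sine (s : ℝ) (k : ℕ+) : ‖sine s k‖ = (k : ℝ) ^ s := by
  have h0 : (0 : ℝ) ≤ (k : ℝ) := by positivity
  rw [norm_def, tsum_eq_single k, coeff_sine]
  · rw [mul_comm 2 s, Real.rpow_mul h0]
    simp [Real.sqrt_sq (Real.rpow_nonneg h0 s)]
  · intro j hj
    simp [coeff_sine, Pi.single_eq_of_ne hj]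

theorem incl_sine {r s : ℝ} (h : s ≤ r) (k : ℕ+) : incl h (sine r k) = sine s k := rfl

theorem incl_real_smul {r s : ℝ} (h : s ≤ r) (a : ℝ) (f : D r) :
    incl h (a • f) = a • incl h f := rfl

theorem incl_smul_sine {r s : ℝ} (h : s ≤ r) (f : ℝ → ℝ) (k : ℕ+) :
    (fun t => incl h (f t • sine r k)) = fun t => f t • sine s k := rfl

theorem dxx_real_smul_sine {s : ℝ} (a : ℝ) (k : ℕ+) :
    dxx (a • sine s k) = (-(k : ℝ) ^ 2 * a) • sine (s - 2) k := by
  refine ext_coeff fun j => ?_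
  have h1 : coeff (a • sine s k) j = (a : ℂ) * Pi.single (M := fun _ => ℂ) k 1 j := rfl
  have h2 : coeff ((-(k : ℝ) ^ 2 * a) • sine (s - 2) k) j
    = ((-(k : ℝ) ^ 2 * a : ℝ) : ℂ) * Pi.single (M := fun _ => ℂ) k 1 j := rfl
  rw [coeff_dxx, h1, h2]
  rcases eq_or_ne j k with rfl | hj
  · push_cast; ring
  · simp [Pi.single_eq_of_ne hj]

end D

/-! ### Solutions mode by mode, and the small divisor criterion -/

open D

theorem hasDerivAt_ofReal_cos_mul (k t : ℝ) :
    HasDerivAt (fun t : ℝ => ((Real.cos (k * t) : ℝ) : ℂ)) (-k * (Real.sin (k * t) : ℝ)) t := by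
  have h := (((hasDerivAt_id' t).const_mul k).cos).ofReal_comp
  exact h.congr_deriv (by push_cast; ring)

theorem hasDerivAt_ofReal_sin_mul (k t : ℝ) :
    HasDerivAt (fun t : ℝ => ((Real.sin (k * t) : ℝ) : ℂ)) (k * (Real.cos (k * t) : ℝ)) t := by
  have h := (((hasDerivAt_id' t).const_mul k).sin).ofReal_comp
  exact h.congr_deriv (by push_cast; ring)

/-- The solutions of `u'' = - k ^ 2 u`. -/
theorem oscillator_eq {k : ℝ} (hk : k ≠ 0) {u v : ℝ → ℂ} (hu : ∀ t, HasDerivAt u (v t) t)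
    (hv : ∀ t, HasDerivAt v (-(k : ℂ) ^ 2 * u t) t) (t : ℝ) :
    u t = u 0 * (Real.cos (k * t) : ℝ) + v 0 / k * (Real.sin (k * t) : ℝ) := by
  have hkc : (k : ℂ) ≠ 0 := by exact_mod_cast hk
  -- Rotating `(u, v / k)` back by the angle `k t` gives two constants of motion.
  have hA : ∀ t, HasDerivAt (fun t => u t * (Real.cos (k * t) : ℝ)
      - v t * ((Real.sin (k * t) : ℝ) : ℂ) / k) 0 t := fun t => by
    refine (((hu t).mul (hasDerivAt_ofReal_cos_mul k t)).sub
      (((hv t).mul (hasDerivAt_ofReal_sin_mul k t)).div_const (k : ℂ))).congr_deriv ?_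
    field_simp
    ring
  have hB : ∀ t, HasDerivAt (fun t => u t * (Real.sin (k * t) : ℝ)
      + v t * ((Real.cos (k * t) : ℝ) : ℂ) / k) 0 t := fun t => by
    refine (((hu t).mul (hasDerivAt_ofReal_sin_mul k t)).add
      (((hv t).mul (hasDerivAt_ofReal_cos_mul k t)).div_const (k : ℂ))).congr_deriv ?_
    field_simp
    ring
  have hA' := is_const_of_deriv_eq_zero (fun t => (hA t).differentiableAt)
    (fun t => (hA t).deriv) t 0
  have hB' := is_const_of_deriv_eq_zero (fun t => (hB t).differentiableAt)
    (fun t => (hB t).deriv) t 0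
  simp only [mul_zero, Real.cos_zero, Real.sin_zero, Complex.ofReal_one, Complex.ofReal_zero,
    zero_div, mul_one, sub_zero, zero_add] at hA' hB'
  have h1 : ((Real.sin (k * t) : ℝ) : ℂ) ^ 2 + ((Real.cos (k * t) : ℝ) : ℂ) ^ 2 = 1 := by
    exact_mod_cast Real.sin_sq_add_cos_sq (k * t)
  rw [← hA', ← hB']
  linear_combination (-u t) * h1

theorem hasDerivAt_coeff {s : ℝ} {f : ℝ → D s} {f' : D s} {t : ℝ} (h : HasDerivAt f f' t)
    (k : ℕ+) : HasDerivAt (fun t => coeff (f t) k) (coeff f' k) t := by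
  have := ((coeffCLM s k).restrictScalars ℝ).hasFDerivAt.comp_hasDerivAt t h
  exact this

/-- Coefficients are continuous linear functionals, so the equation in `D (s - 2)` becomes `u'' = -k
^ 2 u` for each mode. -/
theorem IsSolution.coeff_eq {s : ℝ} {y₀ : D s} {y₁ : D (s - 1)} {y : ℝ → D s}
    (h : IsSolution y₀ y₁ y) (k : ℕ+) (t : ℝ) :
    coeff (y t) k = coeff y₀ k * (Real.cos (k * t) : ℝ)
      + coeff y₁ k / (k : ℝ) * (Real.sin (k * t) : ℝ) := by
  set F : ℝ → D (s - 2) := fun t => incl (sub_le_self s two_pos.le) (y t) with hF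
  have hF1 : Differentiable ℝ F := h.contDiff_two.differentiable (by norm_num)
  have hF2 : Differentiable ℝ (deriv F) :=
    ((contDiff_succ_iff_deriv (n := 1)).1 h.contDiff_two).2.2.differentiable (by norm_num)
  have e2 : ∀ t, deriv (deriv F) t = dxx (y t) := fun t => by
    rw [← h.wave_eq t, iteratedDeriv_succ, iteratedDeriv_one]
  have hu : ∀ t, HasDerivAt (fun t => coeff (y t) k) (coeff (deriv F t) k) t := fun t =>
    hasDerivAt_coeff (hF1 t).hasDerivAt k
  have hv : ∀ t, HasDerivAt (fun t => coeff (deriv F t) k)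
      (-(((k : ℕ) : ℝ) : ℂ) ^ 2 * coeff (y t) k) t := fun t => by
    have := hasDerivAt_coeff (hF2 t).hasDerivAt k
    rw [e2, coeff_dxx] at this
    exact this
  -- The initial velocity is a derivative in `D (s - 1)`, the equation holds in `D (s - 2)`; both
  -- differentiate the same scalar function.
  have h1 : HasDerivAt (fun t => coeff (y t) k) (coeff y₁ k) 0 := by
    have hd := (h.contDiff_one.differentiable (by norm_num) 0).hasDerivAt
    rw [h.init_deriv] at hd
    exact hasDerivAt_coeff hd k
  have hk : ((k : ℕ) : ℝ) ≠ 0 := by positivity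
  rw [oscillator_eq hk hu hv t, (hu 0).unique h1, h.init]

/-- The vibration of the `k`-th mode that is at rest at time `t₀`. -/
theorem isSolution_sine (s : ℝ) (k : ℕ+) (t₀ : ℝ) :
    IsSolution (Real.sin (k * (0 - t₀)) • sine s k)
      (((k : ℝ) * Real.cos (k * (0 - t₀))) • sine (s - 1) k)
      fun t => Real.sin (k * (t - t₀)) • sine s k := by
  have d1 : ∀ t, HasDerivAt (fun t => Real.sin (k * (t - t₀)))
      ((k : ℝ) * Real.cos (k * (t - t₀))) t := fun t => by
    have := (((hasDerivAt_id' t).sub_const t₀).const_mul (k : ℝ)).sin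
    exact this.congr_deriv (by ring)
  have d2 : ∀ t, HasDerivAt (fun t => (k : ℝ) * Real.cos (k * (t - t₀)))
      (-(k : ℝ) ^ 2 * Real.sin (k * (t - t₀))) t := fun t => by
    have := ((((hasDerivAt_id' t).sub_const t₀).const_mul (k : ℝ)).cos).const_mul (k : ℝ)
    exact this.congr_deriv (by ring)
  have c : ∀ n, ContDiff ℝ n fun t => Real.sin (k * (t - t₀)) := fun n => by fun_prop
  have e1 := incl_smul_sine (sub_le_self s one_pos.le) (fun t => Real.sin (k * (t - t₀))) k
  have e2 := incl_smul_sine (sub_le_self s two_pos.le) (fun t => Real.sin (k * (t - t₀))) k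
  refine ⟨(c 0).continuous.smul continuous_const, ?_, ?_, ?_, rfl, ?_⟩
  · rw [e1]
    exact (c 1).smul contDiff_const
  · rw [e2]
    exact (c 2).smul contDiff_const
  · intro t
    have e : deriv (fun t => Real.sin (k * (t - t₀)) • sine (s - 2) k)
        = fun t => ((k : ℝ) * Real.cos (k * (t - t₀))) • sine (s - 2) k :=
      funext fun t => ((d1 t).smul_const _).deriv
    rw [e2, iteratedDeriv_succ, iteratedDeriv_one, dxx_real_smul_sine, e]
    exact ((d2 t).smul_const _).deriv
  · rw [e1]
    exact ((d1 0).smul_const _).deriv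

/-- Strategic pairs are described by a small divisor condition on `sin (k (t₁ - t₀))`. -/
theorem mem_strategicPairs_iff {r s : ℝ} {p : ℝ × ℝ} :
    p ∈ strategicPairs r s ↔
      ∃ δ : ℝ, 0 < δ ∧ ∀ k : ℕ+, δ ≤ (k : ℝ) ^ (r - s) * |Real.sin (k * (p.2 - p.1))| := by
  constructor
  · rintro ⟨c, hc, H⟩
    refine ⟨c⁻¹, inv_pos.2 hc, fun k => ?_⟩
    have hk : (0 : ℝ) < k := by positivity
    -- Tested on the mode at rest at time `p.1`, the inequality keeps only the observation at `p.2`.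
    have h := H _ _ _ (isSolution_sine (max r s) k p.1)
    simp only [incl_real_smul, incl_sine, norm_smul, norm_sine, sub_self, mul_zero,
      Real.sin_zero, norm_zero, zero_mul, zero_add, Real.norm_eq_abs, abs_mul,
      abs_of_pos hk] at h
    rw [Real.rpow_sub_one hk.ne'] at h
    have h1 : 1 ≤ |Real.sin (k * (0 - p.1))| + |Real.cos (k * (0 - p.1))| := by
      have h0 := Real.sin_sq_add_cos_sq (k * (0 - p.1))
      rw [← sq_abs, ← sq_abs (Real.cos _)] at h0
      nlinarith [abs_nonneg (Real.sin (k * (0 - p.1))), abs_nonneg (Real.cos (k * (0 - p.1)))]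
    have hs : (0 : ℝ) < (k : ℝ) ^ s := by positivity
    have h2 : (k : ℝ) ^ s ≤ c * (|Real.sin (k * (p.2 - p.1))| * (k : ℝ) ^ r) := by
      refine le_trans ?_ h
      have : (k : ℝ) * |Real.cos (k * (0 - p.1))| * ((k : ℝ) ^ s / k)
          = |Real.cos (k * (0 - p.1))| * (k : ℝ) ^ s := by field_simp
      rw [this, ← add_mul]
      nlinarith
    rw [Real.rpow_sub hk, inv_le_iff_one_le_mul₀ hc, ← mul_le_mul_iff_left₀ hs, one_mul]
    refine h2.trans_eq ?_
    field_simp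
  · rintro ⟨δ, hδ, H⟩
    refine ⟨2 * (2 * δ⁻¹), by positivity, fun y₀ y₁ y hy => ?_⟩
    -- Cramer's rule in each mode, with `b` the coefficient of `y₁` divided by `k`; this division
    -- matches the weight `k ^ (s - 1)`.
    have main : ∀ k : ℕ+,
        (k : ℝ) ^ s * ‖coeff y₀ k‖ ≤ δ⁻¹ * ((k : ℝ) ^ r * ‖coeff (y p.1) k‖
          + (k : ℝ) ^ r * ‖coeff (y p.2) k‖) ∧
        (k : ℝ) ^ (s - 1) * ‖coeff y₁ k‖ ≤ δ⁻¹ * ((k : ℝ) ^ r * ‖coeff (y p.1) k‖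
          + (k : ℝ) ^ r * ‖coeff (y p.2) k‖) := fun k => by
      have hk : (0 : ℝ) < k := by positivity
      have hkc : ((k : ℝ) : ℂ) ≠ 0 := by exact_mod_cast hk.ne'
      set a := coeff y₀ k
      set b := coeff y₁ k / ((k : ℝ) : ℂ) with hb
      set P := coeff (y p.1) k
      set Q := coeff (y p.2) k
      have hP : P = a * (Real.cos (k * p.1) : ℝ) + b * (Real.sin (k * p.1) : ℝ) :=
        hy.coeff_eq k p.1
      have hQ : Q = a * (Real.cos (k * p.2) : ℝ) + b * (Real.sin (k * p.2) : ℝ) :=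
        hy.coeff_eq k p.2
      have hdet : ((Real.sin (k * (p.2 - p.1)) : ℝ) : ℂ)
          = (Real.sin (k * p.2) : ℝ) * (Real.cos (k * p.1) : ℝ)
            - (Real.cos (k * p.2) : ℝ) * (Real.sin (k * p.1) : ℝ) := by
        rw [mul_sub, Real.sin_sub]
        push_cast
        ring
      have e1 : ((Real.sin (k * (p.2 - p.1)) : ℝ) : ℂ) * a
          = (Real.sin (k * p.2) : ℝ) * P - (Real.sin (k * p.1) : ℝ) * Q := by
        rw [hdet, hP, hQ]; ring
      have e2 : ((Real.sin (k * (p.2 - p.1)) : ℝ) : ℂ) * b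
          = (Real.cos (k * p.1) : ℝ) * Q - (Real.cos (k * p.2) : ℝ) * P := by
        rw [hdet, hP, hQ]; ring
      have n1 : |Real.sin (k * (p.2 - p.1))| * ‖a‖ ≤ ‖P‖ + ‖Q‖ := by
        have := congrArg norm e1
        rw [norm_mul, Complex.norm_real, Real.norm_eq_abs] at this
        rw [this]
        refine (norm_sub_le _ _).trans ?_
        rw [norm_mul, norm_mul, Complex.norm_real, Complex.norm_real]
        exact add_le_add (mul_le_of_le_one_left (norm_nonneg _) (Real.abs_sin_le_one _))
          (mul_le_of_le_one_left (norm_nonneg _) (Real.abs_sin_le_one _))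
      have n2 : |Real.sin (k * (p.2 - p.1))| * ‖b‖ ≤ ‖P‖ + ‖Q‖ := by
        have := congrArg norm e2
        rw [norm_mul, Complex.norm_real, Real.norm_eq_abs] at this
        rw [this, add_comm]
        refine (norm_sub_le _ _).trans ?_
        rw [norm_mul, norm_mul, Complex.norm_real, Complex.norm_real]
        exact add_le_add (mul_le_of_le_one_left (norm_nonneg _) (Real.abs_cos_le_one _))
          (mul_le_of_le_one_left (norm_nonneg _) (Real.abs_cos_le_one _))
      have step : ∀ x : ℝ, 0 ≤ x → |Real.sin (k * (p.2 - p.1))| * x ≤ ‖P‖ + ‖Q‖ →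
          (k : ℝ) ^ s * x ≤ δ⁻¹ * ((k : ℝ) ^ r * ‖P‖ + (k : ℝ) ^ r * ‖Q‖) := by
        intro x hx hle
        have hH := H k
        rw [Real.rpow_sub hk, div_mul_eq_mul_div, le_div_iff₀ (by positivity)] at hH
        rw [inv_mul_eq_div, le_div_iff₀ hδ]
        calc (k : ℝ) ^ s * x * δ = (δ * (k : ℝ) ^ s) * x := by ring
          _ ≤ ((k : ℝ) ^ r * |Real.sin (k * (p.2 - p.1))|) * x := by gcongr
          _ = (k : ℝ) ^ r * (|Real.sin (k * (p.2 - p.1))| * x) := by ring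
          _ ≤ (k : ℝ) ^ r * (‖P‖ + ‖Q‖) := by gcongr
          _ = _ := by ring
      refine ⟨step _ (norm_nonneg _) n1, ?_⟩
      have := step _ (norm_nonneg _) n2
      rw [hb, norm_div, Complex.norm_real, Real.norm_of_nonneg hk.le] at this
      rw [Real.rpow_sub_one hk.ne']
      refine le_trans (le_of_eq ?_) this
      field_simp
    have b0 := norm_le_of_coeff_le (inv_pos.2 hδ).le (incl (le_max_right r s) y₀)
      (incl (le_max_left r s) (y p.1)) (incl (le_max_left r s) (y p.2)) fun k => (main k).1
    have b1 := norm_le_of_coeff_le (inv_pos.2 hδ).le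
      (incl (sub_le_sub_right (le_max_right r s) 1) y₁)
      (incl (le_max_left r s) (y p.1)) (incl (le_max_left r s) (y p.2)) fun k => (main k).2
    linarith

end ClassicalString

end

/-! ### Diophantine approximation and the size of `|sin (k T)|` -/

noncomputable section

open MeasureTheory Filter Topology

theorem abs_sin_le_pi_mul_abs_sub (x : ℝ) (j : ℤ) :
    |Real.sin x| ≤ Real.pi * |x / Real.pi - j| := by
  have hπ := Real.pi_pos
  have h1 : |Real.sin x| = |Real.sin (x - j * Real.pi)| := by
    rw [Real.sin_sub_int_mul_pi, abs_mul, abs_zpow, abs_neg, abs_one, one_zpow, one_mul]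
  have h2 : x - j * Real.pi = Real.pi * (x / Real.pi - j) := by field_simp
  rw [h1, h2]
  refine Real.abs_sin_le_abs.trans_eq ?_
  rw [abs_mul, abs_of_pos hπ]

/-- Jordan's inequality `|sin z| ≥ 2 |z| / π` for `|z| ≤ π / 2`, after a shift by the nearest
multiple of `π`. -/
theorem two_mul_abs_sub_round_le_abs_sin (x : ℝ) :
    2 * |x / Real.pi - round (x / Real.pi)| ≤ |Real.sin x| := by
  have hπ := Real.pi_pos
  set j := round (x / Real.pi) with hj
  have h1 : |Real.sin x| = |Real.sin (x - j * Real.pi)| := by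
    rw [Real.sin_sub_int_mul_pi, abs_mul, abs_zpow, abs_neg, abs_one, one_zpow, one_mul]
  have h2 : |x - j * Real.pi| = Real.pi * |x / Real.pi - j| := by
    rw [← abs_of_pos hπ, ← abs_mul, abs_of_pos hπ]
    congr 1
    field_simp
  have h3 : |x / Real.pi - j| ≤ 1 / 2 := abs_sub_round _
  have h4 := Real.mul_abs_le_abs_sin (x := x - j * Real.pi) (by rw [h2]; nlinarith)
  rw [h1]
  refine le_trans (le_of_eq ?_) h4
  rw [h2]
  field_simp

theorem exists_pos_le_of_forall_pos {f : ℕ → ℝ} (hf : ∀ k, 0 < k → 0 < f k) (N : ℕ) :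
    ∃ ε : ℝ, 0 < ε ∧ ∀ k, 0 < k → k ≤ N → ε ≤ f k := by
  induction N with
  | zero => exact ⟨1, one_pos, fun k h1 h2 => by omega⟩
  | succ n ih =>
    obtain ⟨ε, hε, h⟩ := ih
    refine ⟨min ε (f (n + 1)), lt_min hε (hf _ n.succ_pos), fun k h1 h2 => ?_⟩
    rcases Nat.le_succ_iff.1 h2 with h3 | rfl
    · exact (min_le_left _ _).trans (h k h1 h3)
    · exact min_le_right _ _

/-- By Dirichlet's theorem `|sin (k T)|` cannot be bounded below by `δ k ^ (-α)` with `α < 1`. -/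
theorem not_exists_le_rpow_mul_abs_sin {α : ℝ} (hα : α < 1) (T : ℝ) :
    ¬ ∃ δ : ℝ, 0 < δ ∧ ∀ k : ℕ+, δ ≤ (k : ℝ) ^ α * |Real.sin (k * T)| := by
  rintro ⟨δ, hδ, H⟩
  -- A nonnegative exponent is needed to pass from `k ≤ n` to `k ^ β ≤ n ^ β`.
  set β := max α 0 with hβ
  have hβ1 : β < 1 := max_lt hα one_pos
  have hβ0 : 0 ≤ β := le_max_right _ _
  have hlim : Tendsto (fun n : ℕ => Real.pi * (n : ℝ) ^ (-(1 - β))) atTop (𝓝 (Real.pi * 0)) :=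
    ((tendsto_rpow_neg_atTop (by linarith : 0 < 1 - β)).comp
      tendsto_natCast_atTop_atTop).const_mul _
  rw [mul_zero] at hlim
  obtain ⟨n, hn, hn0⟩ := ((hlim.eventually (gt_mem_nhds hδ)).and (eventually_gt_atTop 0)).exists
  obtain ⟨k, hk0, hkn, hk⟩ := Real.exists_nat_abs_mul_sub_round_le (T / Real.pi) hn0
  have h1 := H ⟨k, hk0⟩
  simp only [PNat.mk_coe] at h1
  have h2 := abs_sin_le_pi_mul_abs_sub (k * T) (round (k * (T / Real.pi)))
  rw [mul_div_assoc] at h2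
  have hk1 : (1 : ℝ) ≤ k := by exact_mod_cast hk0
  have hnr : (0 : ℝ) < n := by exact_mod_cast hn0
  have h3 : (k : ℝ) ^ α ≤ (n : ℝ) ^ β :=
    (Real.rpow_le_rpow_of_exponent_le hk1 (le_max_left _ _)).trans
      (Real.rpow_le_rpow (by positivity) (by exact_mod_cast hkn) hβ0)
  have h4 : |Real.sin (k * T)| ≤ Real.pi * (n : ℝ)⁻¹ := by
    refine h2.trans (mul_le_mul_of_nonneg_left (hk.trans ?_) Real.pi_pos.le)
    rw [one_div]
    exact inv_anti₀ hnr (by linarith)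
  have h5 : (n : ℝ) ^ β * (Real.pi * (n : ℝ)⁻¹) = Real.pi * (n : ℝ) ^ (-(1 - β)) := by
    rw [neg_sub, Real.rpow_sub_one hnr.ne']
    ring
  have h6 : (k : ℝ) ^ α * |Real.sin (k * T)| ≤ (n : ℝ) ^ β * (Real.pi * (n : ℝ)⁻¹) :=
    mul_le_mul h3 h4 (abs_nonneg _) (by positivity)
  linarith

/-- Failure of the Liouville property with constant `1` bounds `|x - m / k|` below for all large
`k`; irrationality makes the finitely many other sines nonzero. -/
theorem exists_le_rpow_mul_abs_sin {α T : ℝ} (hirr : Irrational (T / Real.pi))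
    (hL : ¬ LiouvilleWith (α + 1) (T / Real.pi)) :
    ∃ δ : ℝ, 0 < δ ∧ ∀ k : ℕ+, δ ≤ (k : ℝ) ^ α * |Real.sin (k * T)| := by
  set x := T / Real.pi with hx
  have hne : ∀ (k : ℕ) (m : ℤ), x ≠ m / k := fun k m h =>
    hirr ⟨(m / k : ℚ), by rw [h]; push_cast; rfl⟩
  have hsin : ∀ k : ℕ, 2 * |k * x - round (k * x)| ≤ |Real.sin (k * T)| := fun k => by
    have := two_mul_abs_sub_round_le_abs_sin (k * T)
    rwa [mul_div_assoc] at this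
  have hdiv : ∀ (k : ℕ), 0 < k → ∀ m : ℤ, |(k : ℝ) * x - m| = k * |x - m / k| :=
    fun k hk m => by
      have hk' : (0 : ℝ) < k := by exact_mod_cast hk
      rw [← abs_of_pos hk', ← abs_mul, abs_of_pos hk']
      congr 1
      field_simp
  have hev : ∀ᶠ n : ℕ in atTop, ∀ m : ℤ, 1 / (n : ℝ) ^ (α + 1) ≤ |x - m / n| := by
    by_contra h
    refine hL ⟨1, (not_eventually.1 h).mono fun n hn => ?_⟩
    push Not at hn
    exact hn.imp fun m hm => ⟨hne n m, hm⟩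
  obtain ⟨N, hN⟩ := eventually_atTop.1 hev
  obtain ⟨ε, hε, hεN⟩ := exists_pos_le_of_forall_pos
    (f := fun k => (k : ℝ) ^ α * |Real.sin (k * T)|) (fun k hk => by
      have hk' : (0 : ℝ) < k := by exact_mod_cast hk
      refine mul_pos (by positivity) (lt_of_lt_of_le ?_ (hsin k))
      rw [hdiv k hk]
      have := abs_pos.2 (sub_ne_zero.2 (hne k (round (k * x))))
      positivity) N
  refine ⟨min ε 1, lt_min hε one_pos, fun k => ?_⟩
  rcases le_total (k : ℕ) N with h | h
  · exact (min_le_left _ _).trans (hεN k k.pos h)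
  · refine (min_le_right _ _).trans ?_
    have hk' : (0 : ℝ) < k := by positivity
    have h1 := hsin k
    have h2 := hN k h (round (k * x))
    rw [hdiv k k.pos] at h1
    have h3 : (1 : ℝ) = (k : ℝ) ^ α * (k * (1 / (k : ℝ) ^ (α + 1))) := by
      rw [Real.rpow_add_one hk'.ne']
      field_simp
    rw [h3]
    gcongr
    refine le_trans (mul_le_mul_of_nonneg_left h2 hk'.le) ?_
    have := mul_nonneg hk'.le (abs_nonneg (x - round (k * x) / k))
    linarith

theorem ae_div_pi {P : ℝ → Prop} (h : ∀ᵐ x, P x) : ∀ᵐ T, P (T / Real.pi) := by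
  have hπ : (Real.pi)⁻¹ ≠ 0 := inv_ne_zero Real.pi_ne_zero
  have hq : Measure.QuasiMeasurePreserving (fun T : ℝ => T * Real.pi⁻¹) volume volume :=
    ⟨measurable_id.mul_const _, by
      rw [Real.map_volume_mul_right hπ]
      exact Measure.smul_absolutelyContinuous⟩
  simpa only [div_eq_mul_inv] using hq.ae h

theorem ae_snd_sub_fst {P : ℝ → Prop} (h : ∀ᵐ x, P x) : ∀ᵐ p : ℝ × ℝ, P (p.2 - p.1) := by
  have h1 := (quasiMeasurePreserving_neg (volume : Measure ℝ)).ae h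
  have h2 := (quasiMeasurePreserving_sub (volume : Measure ℝ) (volume : Measure ℝ)).ae h1
  simp only [neg_sub] at h2
  exact h2

/-- Badly approximable real numbers. -/
def BadlyApproximable (x : ℝ) : Prop :=
  ∃ δ : ℝ, 0 < δ ∧ ∀ k : ℕ, 0 < k → ∀ m : ℤ, δ / (k : ℝ) ^ 2 ≤ |x - m / k|

theorem exists_le_mul_abs_sin_iff {T : ℝ} :
    (∃ δ : ℝ, 0 < δ ∧ ∀ k : ℕ+, δ ≤ (k : ℝ) ^ (1 : ℝ) * |Real.sin (k * T)|) ↔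
      BadlyApproximable (T / Real.pi) := by
  have hπ := Real.pi_pos
  have hdiv : ∀ (k : ℕ), 0 < k → ∀ m : ℤ,
      |(k : ℝ) * T / Real.pi - m| = k * |T / Real.pi - m / k| :=
    fun k hk m => by
      have hk' : (0 : ℝ) < k := by exact_mod_cast hk
      rw [← abs_of_pos hk', ← abs_mul, abs_of_pos hk']
      congr 1
      field_simp
  simp only [Real.rpow_one]
  constructor
  · rintro ⟨δ, hδ, H⟩
    refine ⟨δ / Real.pi, by positivity, fun k hk m => ?_⟩
    have hk' : (0 : ℝ) < k := by exact_mod_cast hk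
    have h1 := H ⟨k, hk⟩
    have h2 := abs_sin_le_pi_mul_abs_sub (k * T) m
    rw [hdiv k hk] at h2
    simp only [PNat.mk_coe] at h1
    rw [div_div, div_le_iff₀ (by positivity)]
    nlinarith
  · rintro ⟨δ, hδ, H⟩
    refine ⟨δ, hδ, fun k => ?_⟩
    have hk' : (0 : ℝ) < k := by positivity
    have h1 := two_mul_abs_sub_round_le_abs_sin (k * T)
    have h2 := H k k.pos (round (k * T / Real.pi))
    rw [hdiv k k.pos] at h1
    rw [div_le_iff₀ (by positivity)] at h2
    have := abs_nonneg (T / Real.pi - (round ((k : ℝ) * T / Real.pi) : ℤ) / (k : ℕ))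
    nlinarith

/-- Dirichlet's theorem gives some `k` for each `n`. The errors for small `k` are bounded below by
irrationality, which forces `k` to be large once `n` is. -/
theorem frequently_exists_abs_sub_le_of_irrational {x : ℝ} (hx : Irrational x) :
    ∃ᶠ k : ℕ in atTop, ∃ m : ℤ, |x - m / k| ≤ 1 / (k : ℝ) ^ 2 := by
  rw [frequently_atTop]
  intro N
  obtain ⟨ε, hε, hεN⟩ := exists_pos_le_of_forall_pos
    (f := fun k => |(k : ℝ) * x - round (k * x)|) (fun k hk => by
      refine abs_pos.2 (sub_ne_zero.2 ?_)
      exact ((irrational_natCast_mul_iff.2 ⟨hk.ne', hx⟩).ne_int _)) N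
  obtain ⟨n, hn⟩ := exists_nat_one_div_lt hε
  obtain ⟨k, hk0, hkn, hk⟩ := Real.exists_nat_abs_mul_sub_round_le x n.succ_pos
  have hk' : (0 : ℝ) < k := by exact_mod_cast hk0
  have hkN : N ≤ k := by
    by_contra h
    have h1 := hεN k hk0 (by omega)
    have h2 : (1 : ℝ) / ((n + 1 : ℕ) + 1) ≤ 1 / (n + 1) := by
      push_cast
      apply one_div_le_one_div_of_le <;> linarith [(Nat.cast_nonneg n : (0 : ℝ) ≤ n)]
    simp only [Nat.succ_eq_add_one] at hk
    linarith
  refine ⟨k, hkN, round (k * x), ?_⟩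
  have h1 : |(k : ℝ) * x - round (k * x)| = k * |x - round (k * x) / k| := by
    rw [← abs_of_pos hk', ← abs_mul, abs_of_pos hk']
    congr 1
    field_simp
  rw [h1] at hk
  have h3 : (1 : ℝ) / ((n.succ : ℕ) + 1) ≤ 1 / k := by
    apply one_div_le_one_div_of_le hk'
    have : (k : ℝ) ≤ n.succ := by exact_mod_cast hkn
    linarith
  rw [le_div_iff₀ (by positivity)]
  have h4 := hk.trans h3
  rw [le_div_iff₀ hk'] at h4
  nlinarith

/-- Every irrational lies within `1 / k ^ 2` of fractions `m / k` for infinitely many `k`. Scaling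
the radii by a positive constant changes such a limsup set only by a null set (Cassels), so the
constant can be arbitrarily small. -/
theorem ae_not_badlyApproximable : ∀ᵐ x : ℝ, ¬ BadlyApproximable x := by
  set s : ℕ → Set ℝ := fun k => Set.range fun m : ℤ => (m : ℝ) / k with hs
  set ρ : ℕ → ℝ := fun k => 1 / (k : ℝ) ^ 2 with hρ
  have hρ0 : Tendsto ρ atTop (𝓝 0) := by
    have := tendsto_inv_atTop_zero.comp
      ((tendsto_pow_atTop (two_ne_zero)).comp (tendsto_natCast_atTop_atTop (R := ℝ)))
    simpa [hρ, Function.comp_def] using this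
  have h1 : ∀ᵐ x : ℝ, x ∈ blimsup (fun i => Metric.cthickening (ρ i) (s i)) atTop
      fun _ => True := by
    have hc : ∀ᵐ x : ℝ, Irrational x := by
      have := (Set.countable_range ((↑) : ℚ → ℝ)).ae_notMem (volume : Measure ℝ)
      exact this
    filter_upwards [hc] with x hx
    rw [blimsup_true, mem_limsup_iff_frequently_mem]
    refine (frequently_exists_abs_sub_le_of_irrational hx).mono fun k hk => ?_
    obtain ⟨m, hm⟩ := hk
    exact Metric.mem_cthickening_of_dist_le _ _ _ _ ⟨m, rfl⟩ hm
  have h2 : ∀ n : ℕ, ∀ᵐ x : ℝ, x ∈ blimsup (fun i =>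
      Metric.cthickening (1 / ((n : ℝ) + 1) * ρ i) (s i)) atTop fun _ => True := fun n => by
    have e := blimsup_cthickening_mul_ae_eq (volume : Measure ℝ) (fun _ => True) s
      (M := 1 / ((n : ℝ) + 1)) (by positivity) ρ hρ0
    filter_upwards [e.mem_iff, h1] with x hx hx1
    exact hx.2 hx1
  filter_upwards [ae_all_iff.2 h2] with x hx
  rintro ⟨δ, hδ, H⟩
  obtain ⟨n, hn⟩ := exists_nat_one_div_lt hδ
  have hx' := hx n
  rw [blimsup_true, mem_limsup_iff_frequently_mem] at hx'
  obtain ⟨k, hk, hk0⟩ := (hx'.and_eventually (eventually_gt_atTop 0)).exists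
  have hk' : (0 : ℝ) < k := by exact_mod_cast hk0
  have hρk : 0 < ρ k := by positivity
  -- The strict inequality `1 / (n + 1) < δ` leaves room to pass to an open thickening, which
  -- supplies an actual fraction.
  have h3 := Metric.cthickening_subset_thickening' (δ₂ := δ * ρ k) (by positivity)
    (mul_lt_mul_of_pos_right hn hρk) (s k) hk
  obtain ⟨z, ⟨m, rfl⟩, hz⟩ := Metric.mem_thickening_iff.1 h3
  have h4 := H k hk0 m
  rw [Real.dist_eq] at hz
  rw [hρ] at hz
  simp only [mul_one_div] at hz
  linarith

/-! ### Emptiness and measure in the three regimes -/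

namespace ClassicalString

theorem strategicPairs_eq_empty {r s : ℝ} (h : r - s < 1) : strategicPairs r s = ∅ :=
  Set.eq_empty_of_forall_notMem fun p hp =>
    not_exists_le_rpow_mul_abs_sin h (p.2 - p.1) (mem_strategicPairs_iff.1 hp)

theorem ae_mem_strategicPairs {r s : ℝ} (h : 1 < r - s) :
    ∀ᵐ p : ℝ × ℝ, p ∈ strategicPairs r s := by
  have hc : ∀ᵐ x : ℝ, Irrational x :=
    (Set.countable_range ((↑) : ℚ → ℝ)).ae_notMem (volume : Measure ℝ)
  filter_upwards [ae_snd_sub_fst (ae_div_pi (hc.and ae_not_liouvilleWith))] with p hp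
  exact mem_strategicPairs_iff.2
    (exists_le_rpow_mul_abs_sin hp.1 (hp.2 (r - s + 1) (by linarith)))

theorem mem_strategicPairs_iff_badlyApproximable {r s : ℝ} (h : r - s = 1) {p : ℝ × ℝ} :
    p ∈ strategicPairs r s ↔ BadlyApproximable ((p.2 - p.1) / Real.pi) := by
  rw [mem_strategicPairs_iff, h, exists_le_mul_abs_sin_iff]

theorem volume_strategicPairs_eq_zero {r s : ℝ} (h : r - s = 1) :
    volume (strategicPairs r s) = 0 := by
  have : ∀ᵐ p : ℝ × ℝ, p ∉ strategicPairs r s := by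
    filter_upwards [ae_snd_sub_fst (ae_div_pi ae_not_badlyApproximable)] with p hp
    rwa [mem_strategicPairs_iff_badlyApproximable h]
  simpa [ae_iff] using this

end ClassicalString

end

/-! ### Cantor sets of badly approximable numbers and Hausdorff dimension -/

noncomputable section

open MeasureTheory Filter Topology

namespace BadlyApproximable

/-- The lengths of the intervals of the `n`-th generation. -/
def cantorLength (Q n : ℕ) : ℝ := 1 / (2 * (Q : ℝ) ^ (2 * (n + 1)))

theorem cantorLength_pos {Q : ℕ} (hQ : 2 ≤ Q) (n : ℕ) : 0 < cantorLength Q n := by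
  have : (0 : ℝ) < Q := by positivity
  unfold cantorLength
  positivity

/-- A third of an interval thus has room for `N` intervals of the next generation, each followed by
a gap of the same length. -/
theorem cantorLength_eq {Q N : ℕ} (hQ : 2 ≤ Q) (hN : Q ^ 2 = 6 * N) (n : ℕ) :
    cantorLength Q n = 6 * N * cantorLength Q (n + 1) := by
  have h0 : (0 : ℝ) < Q := by positivity
  have h1 : (6 * N : ℝ) = (Q : ℝ) ^ 2 := by exact_mod_cast hN.symm
  unfold cantorLength
  rw [h1]
  field_simp
  ring

theorem cantorLength_eq_inv_pow {Q : ℕ} (hQ : 2 ≤ Q) (n : ℕ) :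
    2 * ((Q : ℝ) ^ 2) ^ 2 * cantorLength Q (n + 1) = (((Q : ℝ) ^ 2) ^ n)⁻¹ := by
  have h0 : (0 : ℝ) < Q := by positivity
  unfold cantorLength
  field_simp
  ring

/-- Distinct fractions with denominators less than `Q ^ (n + 1)` are so far apart that one of the two
outer thirds of an interval of the `n`-th generation stays away from all fractions of denominator in
`[Q ^ n, Q ^ (n + 1))`. -/
theorem exists_third {Q : ℕ} (hQ : 2 ≤ Q) (a : ℝ) (n : ℕ) :
    ∃ b : ℝ, 0 ≤ b ∧ b + cantorLength Q n / 3 ≤ cantorLength Q n ∧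
      ∀ x ∈ Set.Icc (a + b) (a + b + cantorLength Q n / 3), ∀ k : ℕ, Q ^ n ≤ k → k < Q ^ (n + 1) →
        ∀ m : ℤ, 1 / (12 * (Q : ℝ) ^ 2) / (k : ℝ) ^ 2 ≤ |x - m / k| := by
  have hL := cantorLength_pos hQ n
  set L := cantorLength Q n with hLdef
  have hQ0 : (0 : ℝ) < Q := by positivity
  -- The constant `1 / (12 Q ^ 2)` makes the excluded radius at most `L / 6`, half the width of a
  -- third.
  have hsmall : ∀ k : ℕ, Q ^ n ≤ k → 1 / (12 * (Q : ℝ) ^ 2) / (k : ℝ) ^ 2 ≤ L / 6 := by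
    intro k hk
    have hk' : (Q : ℝ) ^ n ≤ k := by exact_mod_cast hk
    have e : L / 6 = 1 / (12 * (Q : ℝ) ^ 2) / ((Q : ℝ) ^ n) ^ 2 := by
      rw [hLdef, cantorLength]
      field_simp
      ring
    rw [e]
    gcongr
  by_contra! H
  obtain ⟨x, hx, k, hk1, hk2, m, hm⟩ := H 0 le_rfl (by linarith)
  obtain ⟨x', hx', k', hk1', hk2', m', hm'⟩ := H (2 / 3 * L) (by positivity) (by linarith)
  replace hm := abs_lt.1 (hm.trans_le (hsmall k hk1))
  replace hm' := abs_lt.1 (hm'.trans_le (hsmall k' hk1'))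
  have hk0 : (0 : ℝ) < k := by exact_mod_cast (pow_pos (by omega : 0 < Q) n).trans_le hk1
  have hk0' : (0 : ℝ) < k' := by exact_mod_cast (pow_pos (by omega : 0 < Q) n).trans_le hk1'
  -- If both outer thirds failed, `m / k` and `m' / k'` would lie on different sides of the midpoint
  -- and less than `2 L` apart. But distinct fractions with these denominators are at least `1 / (k
  -- k') ≥ 2 L` apart.
  have hlt : (m' : ℝ) / k' - m / k < 2 * L := by linarith [hx.1, hx'.2]
  have hpos : 0 < (m' : ℝ) / k' - m / k := by linarith [hx.2, hx'.1]
  have e : (m' : ℝ) / k' - m / k = ((m' * k - m * k' : ℤ) : ℝ) / (k * k') := by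
    push_cast
    field_simp
  rw [e] at hlt hpos
  have h1 : (1 : ℝ) ≤ ((m' * k - m * k' : ℤ) : ℝ) := by
    have : (0 : ℝ) < ((m' * k - m * k' : ℤ) : ℝ) := by
      by_contra h
      exact hpos.not_ge (div_nonpos_of_nonpos_of_nonneg (not_lt.1 h) (by positivity))
    exact_mod_cast this
  have h2 : (k : ℝ) * k' ≤ (Q : ℝ) ^ (n + 1) * (Q : ℝ) ^ (n + 1) := by
    have e1 : (k : ℝ) ≤ (Q : ℝ) ^ (n + 1) := by exact_mod_cast hk2.le
    have e2 : (k' : ℝ) ≤ (Q : ℝ) ^ (n + 1) := by exact_mod_cast hk2'.le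
    gcongr
  have h3 : 2 * L = 1 / ((Q : ℝ) ^ (n + 1) * (Q : ℝ) ^ (n + 1)) := by
    rw [hLdef, cantorLength]
    field_simp
    ring
  rw [h3] at hlt
  have h4 : 1 / ((Q : ℝ) ^ (n + 1) * (Q : ℝ) ^ (n + 1))
      ≤ ((m' * k - m * k' : ℤ) : ℝ) / (k * k') :=
    div_le_div₀ (by linarith) h1 (by positivity) h2
  linarith

variable {Q N : ℕ}

/-- The position of a third as in `exists_third`, relative to the left endpoint of the interval. -/
def thirdOffset (hQ : 2 ≤ Q) (a : ℝ) (n : ℕ) : ℝ := (exists_third hQ a n).choose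

theorem thirdOffset_spec (hQ : 2 ≤ Q) (a : ℝ) (n : ℕ) :
    0 ≤ thirdOffset hQ a n ∧ thirdOffset hQ a n + cantorLength Q n / 3 ≤ cantorLength Q n ∧
      ∀ x ∈ Set.Icc (a + thirdOffset hQ a n) (a + thirdOffset hQ a n + cantorLength Q n / 3),
        ∀ k : ℕ, Q ^ n ≤ k → k < Q ^ (n + 1) →
          ∀ m : ℤ, 1 / (12 * (Q : ℝ) ^ 2) / (k : ℝ) ^ 2 ≤ |x - m / k| :=
  (exists_third hQ a n).choose_spec

/-- The left endpoint of the interval of the `n`-th generation with given address. -/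
def cantorLeft (hQ : 2 ≤ Q) (d : ℕ → Fin N) : ℕ → ℝ
  | 0 => 0
  | n + 1 => cantorLeft hQ d n + thirdOffset hQ (cantorLeft hQ d n) n
      + 2 * (d n : ℕ) * cantorLength Q (n + 1)

/-- The interval of the `n`-th generation with given address. -/
def cantorInterval (hQ : 2 ≤ Q) (d : ℕ → Fin N) (n : ℕ) : Set ℝ :=
  Set.Icc (cantorLeft hQ d n) (cantorLeft hQ d n + cantorLength Q n)

theorem cantorInterval_succ_subset (hQ : 2 ≤ Q) (hN : Q ^ 2 = 6 * N) (d : ℕ → Fin N) (n : ℕ) :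
    cantorInterval hQ d (n + 1) ⊆
      Set.Icc (cantorLeft hQ d n + thirdOffset hQ (cantorLeft hQ d n) n)
        (cantorLeft hQ d n + thirdOffset hQ (cantorLeft hQ d n) n
          + cantorLength Q n / 3) := by
  have hL := cantorLength_pos hQ (n + 1)
  have h1 : ((d n : ℕ) : ℝ) + 1 ≤ N := by exact_mod_cast (d n).2
  refine Set.Icc_subset_Icc ?_ ?_
  · rw [cantorLeft]
    have : 0 ≤ 2 * ((d n : ℕ) : ℝ) * cantorLength Q (n + 1) := by positivity
    linarith
  · rw [cantorLeft, cantorLength_eq hQ hN n]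
    nlinarith

theorem antitone_cantorInterval (hQ : 2 ≤ Q) (hN : Q ^ 2 = 6 * N) (d : ℕ → Fin N) :
    Antitone (cantorInterval hQ d) := by
  refine antitone_nat_of_succ_le fun n => (cantorInterval_succ_subset hQ hN d n).trans ?_
  have h := thirdOffset_spec hQ (cantorLeft hQ d n) n
  exact Set.Icc_subset_Icc (by linarith [h.1]) (by linarith [h.2.1])

/-- The point of the Cantor set with given address. -/
def cantorPoint (hQ : 2 ≤ Q) (d : ℕ → Fin N) : ℝ := ⨆ n, cantorLeft hQ d n

theorem cantorPoint_mem (hQ : 2 ≤ Q) (hN : Q ^ 2 = 6 * N) (d : ℕ → Fin N) (n : ℕ) :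
    cantorPoint hQ d ∈ cantorInterval hQ d n := by
  have := ciSup_mem_iInter_Icc_of_antitone_Icc (antitone_cantorInterval hQ hN d)
    (fun n => by linarith [cantorLength_pos hQ n])
  exact Set.mem_iInter.1 this n

/-- Each denominator `k` lies in one block `[Q ^ n, Q ^ (n + 1))`, `n = Nat.log Q k`, whose
fractions are kept away at generation `n`. -/
theorem badlyApproximable_cantorPoint (hQ : 2 ≤ Q) (hN : Q ^ 2 = 6 * N) (d : ℕ → Fin N) :
    BadlyApproximable (cantorPoint hQ d) := by
  have hQ0 : (0 : ℝ) < Q := by positivity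
  refine ⟨1 / (12 * (Q : ℝ) ^ 2), by positivity, fun k hk m => ?_⟩
  have h := thirdOffset_spec hQ (cantorLeft hQ d (Nat.log Q k)) (Nat.log Q k)
  exact h.2.2 _ (cantorInterval_succ_subset hQ hN d _ (cantorPoint_mem hQ hN d _)) k
    (Nat.pow_log_le_self Q hk.ne') (Nat.lt_pow_succ_log_self (by omega) k) m

theorem cantorLeft_congr (hQ : 2 ≤ Q) {d e : ℕ → Fin N} {n : ℕ} (h : ∀ i < n, d i = e i) :
    cantorLeft hQ d n = cantorLeft hQ e n := by
  induction n with
  | zero => rfl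
  | succ n ih => rw [cantorLeft, cantorLeft, ih fun i hi => h i (by omega), h n (by omega)]

/-- Addresses that first differ at digit `n` share the parent interval, and the gap between siblings
is at least `cantorLength Q (n + 1)`. -/
theorem cantorLength_le_abs_sub (hQ : 2 ≤ Q) (hN : Q ^ 2 = 6 * N) {d e : ℕ → Fin N} {n : ℕ}
    (h : ∀ i < n, d i = e i) (hn : d n ≠ e n) :
    cantorLength Q (n + 1) ≤ |cantorPoint hQ d - cantorPoint hQ e| := by
  wlog hlt : d n < e n generalizing d e
  · rw [abs_sub_comm]
    exact this (fun i hi => (h i hi).symm) hn.symm (lt_of_le_of_ne (not_lt.1 hlt) hn.symm)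
  have hL := cantorLength_pos hQ (n + 1)
  have h1 := (cantorPoint_mem hQ hN d (n + 1)).2
  have h2 := (cantorPoint_mem hQ hN e (n + 1)).1
  rw [cantorLeft] at h1 h2
  rw [cantorLeft_congr hQ h] at h1
  have h3 : ((d n : ℕ) : ℝ) + 1 ≤ (e n : ℕ) := by exact_mod_cast hlt
  rw [abs_sub_comm]
  refine le_trans ?_ (le_abs_self _)
  nlinarith

/-- Hölder continuity of the map from the Cantor set to the unit interval that reads the address of a
point as an expansion in base `N`. -/
theorem abs_ofDigits_sub_le_cantorPoint (hQ : 2 ≤ Q) (hN : Q ^ 2 = 6 * N) {ρ : ℝ} (hρ : 0 ≤ ρ)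
    (hρN : ((Q : ℝ) ^ 2) ^ ρ = N) (d e : ℕ → Fin N) :
    |Real.ofDigits d - Real.ofDigits e|
      ≤ (2 * ((Q : ℝ) ^ 2) ^ 2) ^ ρ * |cantorPoint hQ d - cantorPoint hQ e| ^ ρ := by
  classical
  have hQ0 : (0 : ℝ) < Q := by positivity
  by_cases hde : d = e
  · subst hde
    rw [sub_self, abs_zero]
    positivity
  have hex : ∃ n, d n ≠ e n := Function.ne_iff.1 hde
  have hfind : ∀ i < Nat.find hex, d i = e i := fun i hi => not_not.1 (Nat.find_min hex hi)
  refine (Real.abs_ofDigits_sub_ofDigits_le hfind).trans ?_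
  have h1 := cantorLength_le_abs_sub hQ hN hfind (Nat.find_spec hex)
  have h2 := cantorLength_eq_inv_pow hQ (Nat.find hex)
  -- The choice `N = (Q ^ 2) ^ ρ` turns the digit scale `N ^ (-n)` into the power `ρ` of `Q ^ (-2
  -- n)`, a fixed multiple of the gap.
  have h3 : ((N : ℝ) ^ Nat.find hex)⁻¹ = ((((Q : ℝ) ^ 2) ^ Nat.find hex)⁻¹) ^ ρ := by
    have h4 : ∀ X : ℝ, 0 ≤ X → ∀ j : ℕ, (X ^ ρ) ^ j = (X ^ j) ^ ρ := fun X hX j => by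
      rw [← Real.rpow_mul_natCast hX, ← Real.rpow_natCast_mul hX, mul_comm]
    rw [← hρN, Real.inv_rpow (by positivity), h4 _ (by positivity)]
  rw [h3, ← h2, ← Real.mul_rpow (by positivity) (abs_nonneg _)]
  have := (cantorLength_pos hQ (Nat.find hex + 1)).le
  gcongr

/-- There are Cantor sets of badly approximable numbers that Hölder functions with exponent close
to `1` map onto the unit interval. -/
theorem exists_holder_surjOn (hQ : 2 ≤ Q) (hN : Q ^ 2 = 6 * N) (hN2 : 2 ≤ N) {ρ : ℝ} (hρ : 0 < ρ)
    (hρN : ((Q : ℝ) ^ 2) ^ ρ = N) :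
    ∃ (K : Set ℝ) (f : ℝ → ℝ) (C : ℝ), 1 ≤ C ∧ (∀ x ∈ K, BadlyApproximable x) ∧
      Set.Icc 0 1 ⊆ f '' K ∧ ∀ x ∈ K, ∀ y ∈ K, |f x - f y| ≤ C * |x - y| ^ ρ := by
  have : NeZero N := ⟨by omega⟩
  have hinv : ∀ x ∈ Set.range (cantorPoint (N := N) hQ),
      cantorPoint hQ (Function.invFun (cantorPoint (N := N) hQ) x) = x :=
    fun x hx => Function.invFun_eq hx
  have hQ1 : (2 : ℝ) ≤ Q := by exact_mod_cast hQ
  refine ⟨Set.range (cantorPoint (N := N) hQ),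
    fun x => Real.ofDigits (Function.invFun (cantorPoint (N := N) hQ) x),
    (2 * ((Q : ℝ) ^ 2) ^ 2) ^ ρ, ?_, ?_, ?_, ?_⟩
  · refine Real.one_le_rpow ?_ hρ.le
    have : 1 ≤ ((Q : ℝ) ^ 2) ^ 2 := one_le_pow₀ (one_le_pow₀ (by linarith))
    linarith
  · rintro _ ⟨d, rfl⟩
    exact badlyApproximable_cantorPoint hQ hN d
  · intro u hu
    obtain ⟨d, -, rfl⟩ := Real.ofDigits_SurjOn (b := N) (by omega) hu
    refine ⟨cantorPoint hQ d, ⟨d, rfl⟩, ?_⟩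
    -- Two addresses of one point have equal digit values by the Hölder bound at distance zero, so
    -- the address picked by `invFun` is harmless.
    have h := abs_ofDigits_sub_le_cantorPoint hQ hN hρ.le hρN
      (Function.invFun (cantorPoint (N := N) hQ) (cantorPoint hQ d)) d
    rw [hinv _ ⟨d, rfl⟩, sub_self, abs_zero, Real.zero_rpow hρ.ne', mul_zero] at h
    exact sub_eq_zero.1 (abs_nonpos_iff.1 h)
  · intro x hx y hy
    have h := abs_ofDigits_sub_le_cantorPoint hQ hN hρ.le hρN
      (Function.invFun (cantorPoint (N := N) hQ) x) (Function.invFun (cantorPoint (N := N) hQ) y)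
    rwa [hinv x hx, hinv y hy] at h

end BadlyApproximable

/-- If a Hölder function of exponent `ρ` maps `K` onto the unit interval, then the pairs of times whose
difference lies in `π K` form a set of dimension at least `2 ρ`. -/
theorem two_mul_le_dimH_of_holder {K : Set ℝ} {f : ℝ → ℝ} {C ρ : ℝ} (hC : 1 ≤ C) (hρ : 0 < ρ)
    (hρ1 : ρ ≤ 1) (hf : Set.Icc 0 1 ⊆ f '' K)
    (hK : ∀ x ∈ K, ∀ y ∈ K, |f x - f y| ≤ C * |x - y| ^ ρ) :
    2 * ENNReal.ofReal ρ ≤ dimH {p : ℝ × ℝ | (p.2 - p.1) / Real.pi ∈ K} := by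
  have hπ := Real.pi_pos
  -- Confining `p.1` to `[0, 1]` makes the identity in that coordinate `ρ`-Hölder, as `ρ ≤ 1`.
  set S : Set (ℝ × ℝ) := {p | p.1 ∈ Set.Icc (0 : ℝ) 1 ∧ (p.2 - p.1) / Real.pi ∈ K} with hS
  set F : ℝ × ℝ → ℝ × ℝ := fun p => (p.1, f ((p.2 - p.1) / Real.pi)) with hF
  have hdist : ∀ p ∈ S, ∀ q ∈ S, dist (F p) (F q) ≤ C * dist p q ^ ρ := by
    intro p hp q hq
    have h1 : |p.1 - q.1| ≤ dist p q := by
      rw [← Real.dist_eq]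
      exact le_max_left _ _
    have h2 : |p.2 - q.2| ≤ dist p q := by
      rw [← Real.dist_eq]
      exact le_max_right _ _
    refine max_le ?_ ?_
    · rw [Real.dist_eq]
      have h3 : |p.1 - q.1| ≤ 1 := by
        rw [abs_le]
        constructor <;> linarith [hp.1.1, hp.1.2, hq.1.1, hq.1.2]
      calc |p.1 - q.1| ≤ |p.1 - q.1| ^ ρ := by
            simpa using Real.rpow_le_rpow_of_exponent_ge' (abs_nonneg _) h3 hρ.le hρ1
        _ ≤ dist p q ^ ρ := by gcongr
        _ ≤ C * dist p q ^ ρ := le_mul_of_one_le_left (by positivity) hC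
    · rw [Real.dist_eq]
      refine (hK _ hp.2 _ hq.2).trans ?_
      -- The factor `2` from the difference of coordinates is absorbed by `π > 2`.
      have h3 : |(p.2 - p.1) / Real.pi - (q.2 - q.1) / Real.pi| ≤ dist p q := by
        rw [← sub_div, abs_div, abs_of_pos hπ, div_le_iff₀ hπ]
        have h4 : |p.2 - p.1 - (q.2 - q.1)| ≤ |p.2 - q.2| + |p.1 - q.1| := by
          rw [show p.2 - p.1 - (q.2 - q.1) = (p.2 - q.2) - (p.1 - q.1) by ring]
          exact abs_sub _ _
        nlinarith [Real.pi_gt_three, dist_nonneg (x := p) (y := q)]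
      gcongr
  have hHolder : HolderOnWith C.toNNReal ρ.toNNReal F S := by
    intro p hp q hq
    have h := hdist p hp q hq
    rw [edist_dist, edist_dist, Real.coe_toNNReal _ hρ.le,
      ENNReal.ofReal_rpow_of_nonneg dist_nonneg hρ.le]
    change _ ≤ ENNReal.ofReal C * _
    rw [← ENNReal.ofReal_mul (by linarith)]
    exact ENNReal.ofReal_le_ofReal h
  have hsub : Set.Icc (0 : ℝ) 1 ×ˢ Set.Icc (0 : ℝ) 1 ⊆ F '' S := by
    rintro ⟨t, u⟩ ⟨ht, hu⟩
    obtain ⟨x, hx, rfl⟩ := hf hu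
    have e : (t + Real.pi * x - t) / Real.pi = x := by field_simp; ring
    exact ⟨(t, t + Real.pi * x), ⟨ht, by rwa [e]⟩, by simp only [hF, e]⟩
  have hdim : dimH (Set.Icc (0 : ℝ) 1 ×ˢ Set.Icc (0 : ℝ) 1) = 2 := by
    rw [Real.dimH_of_nonempty_interior]
    · simp
    · rw [interior_prod_eq, interior_Icc]
      exact ⟨(1 / 2, 1 / 2), by norm_num, by norm_num⟩
  have hle := (dimH_mono hsub).trans (hHolder.dimH_image_le (Real.toNNReal_pos.2 hρ))
  rw [hdim] at hle
  have hSK : S ⊆ {p : ℝ × ℝ | (p.2 - p.1) / Real.pi ∈ K} := fun p hp => hp.2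
  refine (ENNReal.mul_le_of_le_div hle).trans (dimH_mono hSK)

/-- With `Q = 6 (n + 1)` and `N = Q ^ 2 / 6` the Hölder exponent is `log N / log Q ^ 2 = 1 - log 6 /
log Q ^ 2`, which tends to `1`: the loss of the factor `6` per generation becomes negligible. -/
theorem dimH_setOf_badlyApproximable_sub_div_pi :
    dimH {p : ℝ × ℝ | BadlyApproximable ((p.2 - p.1) / Real.pi)} = 2 := by
  refine le_antisymm ((dimH_mono (Set.subset_univ _)).trans_eq ?_) ?_
  · rw [Real.dimH_univ_eq_finrank]
    simp
  set ρ : ℕ → ℝ := fun n => 1 - Real.log 6 / Real.log (((6 * (n + 1) : ℕ) : ℝ) ^ 2) with hρ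
  have hbase : Tendsto (fun n : ℕ => ((6 * (n + 1) : ℕ) : ℝ) ^ 2) atTop atTop := by
    refine (tendsto_pow_atTop two_ne_zero).comp (tendsto_natCast_atTop_atTop.comp ?_)
    exact tendsto_atTop_mono (fun n => by simp only [id]; omega) tendsto_id
  have hlim : Tendsto ρ atTop (𝓝 1) := by
    have := (tendsto_const_nhds (x := Real.log 6)).div_atTop (Real.tendsto_log_atTop.comp hbase)
    simpa [hρ] using this.const_sub 1
  have hlim' : Tendsto (fun n => 2 * ENNReal.ofReal (ρ n)) atTop (𝓝 2) := by
    have := ENNReal.Tendsto.const_mul (a := 2)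
      (ENNReal.tendsto_ofReal hlim) (Or.inr (by norm_num))
    simpa using this
  refine le_of_tendsto' hlim' fun n => ?_
  set Q := 6 * (n + 1) with hQ
  set N := 6 * (n + 1) ^ 2 with hN
  have hQN : Q ^ 2 = 6 * N := by rw [hQ, hN]; ring
  have hQ2 : 2 ≤ Q := by omega
  have hN2 : 2 ≤ N := by
    have : 0 < (n + 1) ^ 2 := by positivity
    omega
  have hQNr : (Q : ℝ) ^ 2 = 6 * N := by exact_mod_cast hQN
  have hNr : (2 : ℝ) ≤ N := by exact_mod_cast hN2
  have hlog : 0 < Real.log ((Q : ℝ) ^ 2) := Real.log_pos (by rw [hQNr]; linarith)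
  have hlog6 : 0 < Real.log 6 := Real.log_pos (by norm_num)
  have hρn : ρ n = Real.log N / Real.log ((Q : ℝ) ^ 2) := by
    have h1 : Real.log ((Q : ℝ) ^ 2) = Real.log 6 + Real.log N := by
      rw [hQNr, Real.log_mul (by norm_num) (by positivity)]
    rw [hρ]
    simp only []
    rw [eq_div_iff hlog.ne', sub_mul, div_mul_cancel₀ _ hlog.ne', h1]
    ring
  have hρ0 : 0 < ρ n := by
    rw [hρn]
    exact div_pos (Real.log_pos (by linarith)) hlog
  have hρ1 : ρ n ≤ 1 := by
    have : 0 ≤ Real.log 6 / Real.log ((Q : ℝ) ^ 2) := by positivity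
    simp only [hρ]
    linarith
  have hρN : ((Q : ℝ) ^ 2) ^ ρ n = N := by
    rw [hρn, Real.rpow_def_of_pos (by rw [hQNr]; positivity), mul_div_cancel₀ _ hlog.ne',
      Real.exp_log (by positivity)]
  obtain ⟨K, f, C, hC, hK, hf, hfK⟩ :=
    BadlyApproximable.exists_holder_surjOn hQ2 hQN hN2 hρ0 hρN
  exact (two_mul_le_dimH_of_holder hC hρ0 hρ1 hf hfK).trans (dimH_mono fun p hp => hK _ hp)

namespace ClassicalString

theorem dimH_strategicPairs {r s : ℝ} (h : r - s = 1) : dimH (strategicPairs r s) = 2 := by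
  rw [← dimH_setOf_badlyApproximable_sub_div_pi]
  congr 1
  ext p
  exact mem_strategicPairs_iff_badlyApproximable h

end ClassicalString

end

theorem theorem3p3 (r s : ℝ) :
    (r - s < 1 → ClassicalString.strategicPairs r s = ∅) ∧
    (r - s = 1 → MeasureTheory.volume (ClassicalString.strategicPairs r s) = 0 ∧
      dimH (ClassicalString.strategicPairs r s) = 2) ∧
    (1 < r - s → ∀ᵐ p : ℝ × ℝ, p ∈ ClassicalString.strategicPairs r s) :=
  ⟨ClassicalString.strategicPairs_eq_empty,
    fun h => ⟨ClassicalString.volume_strategicPairs_eq_zero h,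
      ClassicalString.dimH_strategicPairs h⟩,
    ClassicalString.ae_mem_strategicPairs⟩
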